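/- Throughout, Banach lattices are real and operators are bounded and linear. Let $L$ be a Banach lattice with order continuous norm (every decreasing net in $L$ with infimum $0$ converges to $0$ in norm). An ideal of $L$ is a linear subspace $J$ such that $|x|\le|y|$ and $y\in J$ imply $x\in J$; a band is an order closed ideal, itself regarded as a normed Riesz space with the inherited norm and order. A positive operator $T$ is strictly positive if $T|x|=0$ implies $x=0$. An operator is ideal-irreducible if it leaves invariant no closed ideal other than $\{0\}$ and the whole space, and ideal-triangularizable if there is a chain of closed ideals, maximal among all chains of closed ideals of the space, each of whose members is invariant under the operator. Let $P$ be a positive idempotent operator on $L$ of finite rank $r$ such that $P$ is strictly positive on $L$ and its adjoint $P^*$ is strictly positive on the dual Banach lattice $L^*$. Then there exist pairwise disjoint bands $L_1,\dots,L_r$ in $L$ such that $L=L_1\oplus\cdots\oplus L_r$ and $P=P_1\oplus\cdots\oplus P_r$, where, for each $j$, $P_j$ is an ideal-irreducible positive idempotent operator of rank $1$ on $L_j$ (so each $L_j$ is invariant under $P$ and $P_j=P|_{L_j}$). If, in addition, $P$ is ideal-triangularizable, then $r=\dim L$ and $P$ is the identity operator on $L$. -/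

import Mathlib

open Filter Topology

universe u

namespace BanachLattice

section Basic

variable {L : Type u} [NormedAddCommGroup L] [NormedSpace ℝ L] [Lattice L]

/-- The norm of `L` is order continuous: every decreasing net with infimum `0` converges to `0` in
norm. (A decreasing net may be re-indexed by its range, so index types in the universe of `L`
suffice.) -/
def HasOrderContinuousNorm (L : Type u) [NormedAddCommGroup L] [Lattice L] : Prop :=
  ∀ (ι : Type u) [Preorder ι] [IsDirectedOrder ι] [Nonempty ι] (x : ι → L),
    Antitone x → IsGLB (Set.range x) 0 → Tendsto x atTop (𝓝 0)

/-- An ideal of `L`: a linear subspace `J` such that `|x| ≤ |y|` and `y ∈ J` imply `x ∈ J`. -/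
def IsIdeal (J : Submodule ℝ L) : Prop :=
  ∀ ⦃x y : L⦄, |x| ≤ |y| → y ∈ J → x ∈ J

/-- A norm closed ideal. -/
def IsClosedIdeal (J : Submodule ℝ L) : Prop :=
  IsIdeal J ∧ IsClosed (J : Set L)

/-- The net `x` converges in order to `a`: some net `y` decreasing to `0` has `|x i - a| ≤ y i`. -/
def OrderTendsto {ι : Type u} [Preorder ι] (x : ι → L) (a : L) : Prop :=
  ∃ y : ι → L, Antitone y ∧ IsGLB (Set.range y) 0 ∧ ∀ i, |x i - a| ≤ y i

/-- A set is order closed if it contains the order limits of all nets in it. -/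
def IsOrderClosed (S : Set L) : Prop :=
  ∀ (ι : Type u) [Preorder ι] [IsDirectedOrder ι] [Nonempty ι] (x : ι → L) (a : L),
    (∀ i, x i ∈ S) → OrderTendsto x a → a ∈ S

/-- A positive operator. -/
def IsPositive (T : L →L[ℝ] L) : Prop :=
  ∀ x : L, 0 ≤ x → 0 ≤ T x

/-- The absolute kernel `{x | T |x| = 0}` of an operator on `L`. -/
def absKernel (T : L →L[ℝ] L) : Set L :=
  {x | T |x| = 0}

/-- A positive operator on `L` is strictly positive if its absolute kernel is zero. -/
def IsStrictlyPositive (T : L →L[ℝ] L) : Prop :=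
  IsPositive T ∧ absKernel T = {0}

/-- The order of the dual `L*`: `φ ≤ ψ` iff `φ x ≤ ψ x` for all `x ≥ 0`. -/
def DualLE (φ ψ : StrongDual ℝ L) : Prop :=
  ∀ x : L, 0 ≤ x → φ x ≤ ψ x

/-- `μ` is the modulus `|φ|` of `φ` in `L*`, i.e. the least upper bound of `φ` and `-φ`. -/
def IsDualModulus (φ μ : StrongDual ℝ L) : Prop :=
  DualLE φ μ ∧ DualLE (-φ) μ ∧ ∀ θ, DualLE φ θ → DualLE (-φ) θ → DualLE μ θ

/-- A positive operator on `L*`. -/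
def IsDualPositive (S : StrongDual ℝ L →L[ℝ] StrongDual ℝ L) : Prop :=
  ∀ φ, DualLE 0 φ → DualLE 0 (S φ)

/-- The absolute kernel `{φ | S |φ| = 0}` of an operator on `L*`. -/
def dualAbsKernel (S : StrongDual ℝ L →L[ℝ] StrongDual ℝ L) : Set (StrongDual ℝ L) :=
  {φ | ∃ μ, IsDualModulus φ μ ∧ S μ = 0}

/-- A positive operator on `L*` is strictly positive if its absolute kernel is zero. -/
def IsDualStrictlyPositive (S : StrongDual ℝ L →L[ℝ] StrongDual ℝ L) : Prop :=
  IsDualPositive S ∧ dualAbsKernel S = {0}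

/-- The adjoint operator `T* φ = φ ∘ T` on `L*`. -/
noncomputable def adjoint (T : L →L[ℝ] L) : StrongDual ℝ L →L[ℝ] StrongDual ℝ L :=
  ContinuousLinearMap.precomp ℝ T

/-- `J` is invariant under `T`. -/
def IsInvariant (T : L →L[ℝ] L) (J : Submodule ℝ L) : Prop :=
  ∀ x ∈ J, T x ∈ J

/-- `T` is ideal-reducible if it leaves invariant a closed ideal other than `{0}` and `L`. -/
def IsIdealReducible (T : L →L[ℝ] L) : Prop :=
  ∃ J : Submodule ℝ L, IsClosedIdeal J ∧ J ≠ ⊥ ∧ J ≠ ⊤ ∧ IsInvariant T J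

/-- `T` is ideal-irreducible. -/
def IsIdealIrreducible (T : L →L[ℝ] L) : Prop :=
  ¬ IsIdealReducible T

/-- `C` is a chain of closed ideals of `L`. -/
def IsClosedIdealChain (C : Set (Submodule ℝ L)) : Prop :=
  (∀ J ∈ C, IsClosedIdeal J) ∧ IsChain (· ≤ ·) C

/-- `T` is ideal-triangularizable: there is a chain, maximal among all chains of closed ideals
of `L`, whose members are all invariant under `T`. -/
def IsIdealTriangularizable (T : L →L[ℝ] L) : Prop :=
  ∃ C : Set (Submodule ℝ L), Maximal IsClosedIdealChain C ∧ ∀ J ∈ C, IsInvariant T J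

/-- Two subspaces are disjoint in the lattice sense: `|x| ∧ |y| = 0` for `x ∈ A`, `y ∈ B`. -/
def LatticeDisjoint (A B : Submodule ℝ L) : Prop :=
  ∀ x ∈ A, ∀ y ∈ B, |x| ⊓ |y| = 0

end Basic

/-- A band of `L`: an order closed ideal. -/
structure Band (L : Type u) [NormedAddCommGroup L] [NormedSpace ℝ L] [Lattice L] where
  /-- The underlying linear subspace, with the norm inherited from `L`. -/
  carrier : Submodule ℝ L
  isIdeal : IsIdeal carrier
  isOrderClosed : IsOrderClosed (carrier : Set L)

namespace Band

variable {L : Type u} [NormedAddCommGroup L] [NormedSpace ℝ L] [Lattice L] [IsOrderedAddMonoid L]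

theorem abs_mem (B : Band L) {x : L} (hx : x ∈ B.carrier) : |x| ∈ B.carrier :=
  B.isIdeal (abs_abs x).le hx

theorem sup_mem (B : Band L) {x y : L} (hx : x ∈ B.carrier) (hy : y ∈ B.carrier) :
    x ⊔ y ∈ B.carrier := by
  refine B.isIdeal (y := |x| + |y|) ?_ (B.carrier.add_mem (B.abs_mem hx) (B.abs_mem hy))
  rw [abs_of_nonneg (add_nonneg (abs_nonneg x) (abs_nonneg y))]
  refine sup_le (sup_le ?_ ?_) ?_
  · exact (le_abs_self x).trans (le_add_of_nonneg_right (abs_nonneg y))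
  · exact (le_abs_self y).trans (le_add_of_nonneg_left (abs_nonneg x))
  · rw [neg_sup]
    exact inf_le_left.trans ((neg_le_abs x).trans (le_add_of_nonneg_right (abs_nonneg y)))

theorem inf_mem (B : Band L) {x y : L} (hx : x ∈ B.carrier) (hy : y ∈ B.carrier) :
    x ⊓ y ∈ B.carrier := by
  have h := B.carrier.neg_mem (B.sup_mem (B.carrier.neg_mem hx) (B.carrier.neg_mem hy))
  rwa [neg_sup, neg_neg, neg_neg] at h

/-- A band is a vector lattice in the order inherited from `L`. -/
instance (B : Band L) : Lattice B.carrier :=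
  Subtype.lattice (fun _ _ hx hy => B.sup_mem hx hy) (fun _ _ hx hy => B.inf_mem hx hy)

end Band

end BanachLattice

namespace BanachLattice

/-! ### Lattice-ordered groups. -/

section OrderedGroup

variable {L : Type u} [AddCommGroup L] [Lattice L] [IsOrderedAddMonoid L]

/-! Strict positivity of `P` makes its range a vector sublattice: if `P x = x`, then `|x| ≤ P |x|`,
and `P` kills the difference. A finite-dimensional vector sublattice has a basis of disjoint
positive vectors (`exists_disjointSystem_span`), so the range has such a basis `x₁, …, x_r`. Let
`L_j` be the closed ideal generated by `x_j`. These ideals are disjoint and `P`-invariant. Their sum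
is a closed ideal containing the range of `P`, hence is all of `L`: otherwise a nonzero positive
functional would vanish on it, against strict positivity of `P*` (`eq_top_of_range_le`). Order
continuity of the norm serves only to turn closed ideals into bands.

On `L_j` the fixed vectors of `P` are the multiples of `x_j`. If an invariant closed ideal contains
a nonzero `y` of `L_j`, it contains `P |y|`, a nonzero multiple of `x_j`, and so all of `L_j`; this
gives irreducibility. In the triangularizable case, the same fact and the maximality of the chain
force each `L_j` to be totally ordered. Then `y - P y` has a sign and is killed by `P`, so `P y =
y`. -/

theorem eq_zero_of_abs_eq_zero {x : L} (h : |x| = 0) : x = 0 :=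
  le_antisymm (h ▸ le_abs_self x) (by
    have := neg_le_abs x
    rwa [h, neg_nonpos] at this)

theorem inf_add_eq_zero {a b w : L} (ha : 0 ≤ a) (hb : 0 ≤ b) (hw : 0 ≤ w)
    (haw : a ⊓ w = 0) (hbw : b ⊓ w = 0) : (a + b) ⊓ w = 0 := by
  refine le_antisymm ?_ (le_inf (add_nonneg ha hb) hw)
  have h1 : (a + b) ⊓ w - b ≤ a ⊓ w := by
    refine le_inf ?_ ?_
    · rw [sub_le_iff_le_add]; exact inf_le_left
    · exact (sub_le_self _ hb).trans inf_le_right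
  rw [haw, sub_nonpos] at h1
  exact (le_inf h1 inf_le_right).trans hbw.le

/-- The Riesz decomposition property. -/
theorem exists_add_eq_of_abs_le_add {x a b : L} (ha : 0 ≤ a) (hb : 0 ≤ b) (h : |x| ≤ a + b) :
    ∃ x₁ x₂, |x₁| ≤ a ∧ |x₂| ≤ b ∧ x₁ + x₂ = x := by
  obtain ⟨h1, h2⟩ := abs_le'.1 h
  -- The first summand is the truncation of `x` to the order interval `[-a, a]`.
  refine ⟨(x ⊓ a) ⊔ (-a), x - (x ⊓ a) ⊔ (-a), abs_le'.2 ⟨?_, ?_⟩, abs_le'.2 ⟨?_, ?_⟩, by abel⟩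
  · exact sup_le inf_le_right ((neg_nonpos.2 ha).trans ha)
  · rw [neg_le]; exact le_sup_right
  · rw [sub_le_comm]
    refine le_trans (le_inf (sub_le_self _ hb) ?_) le_sup_left
    rwa [sub_le_iff_le_add]
  · rw [neg_sub, sub_le_iff_le_add]
    refine sup_le (inf_le_left.trans (le_add_of_nonneg_left hb)) ?_
    rw [neg_le_iff_add_nonneg] at h2 ⊢
    convert h2 using 1
    abel

theorem abs_posPart_le (x : L) : |x⁺| ≤ |x| := by
  rw [abs_of_nonneg (posPart_nonneg x), ← posPart_add_negPart x]
  exact le_add_of_nonneg_right (negPart_nonneg x)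

theorem abs_negPart_le (x : L) : |x⁻| ≤ |x| := by
  rw [abs_of_nonneg (negPart_nonneg x), ← posPart_add_negPart x]
  exact le_add_of_nonneg_left (posPart_nonneg x)

end OrderedGroup

/-! ### Ideals and disjoint complements. -/

section Ideal

variable {L : Type u} [NormedAddCommGroup L] [NormedSpace ℝ L] [Lattice L]
  [IsOrderedAddMonoid L]

theorem IsIdeal.abs_mem {J : Submodule ℝ L} (hJ : IsIdeal J) {x : L} (hx : x ∈ J) : |x| ∈ J :=
  hJ (abs_abs x).le hx

theorem IsIdeal.of_abs_mem {J : Submodule ℝ L} (hJ : IsIdeal J) {x : L} (hx : |x| ∈ J) : x ∈ J :=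
  hJ (abs_abs x).ge hx

/-- A supremum of ideals is an ideal. -/
theorem isIdeal_iSup {ι : Sort*} {J : ι → Submodule ℝ L} (hJ : ∀ i, IsIdeal (J i)) :
    IsIdeal (⨆ i, J i) := by
  intro x y hxy hy
  induction hy using Submodule.iSup_induction' generalizing x with
  | mem i y hy => exact Submodule.mem_iSup_of_mem i (hJ i hxy hy)
  | zero =>
    rw [abs_zero] at hxy
    rw [eq_zero_of_abs_eq_zero (le_antisymm hxy (abs_nonneg x))]
    exact Submodule.zero_mem _
  | add a b _ _ iha ihb =>
    obtain ⟨x₁, x₂, h1, h2, rfl⟩ := exists_add_eq_of_abs_le_add (abs_nonneg a) (abs_nonneg b)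
      (hxy.trans (abs_add_le a b))
    exact Submodule.add_mem _ (iha h1) (ihb h2)

variable [IsOrderedModule ℝ L]

omit [IsOrderedAddMonoid L] in
theorem abs_smul_le (c : ℝ) (z : L) : |c • z| ≤ |c| • |z| := by
  have key : ∀ z : L, c • z ≤ |c| • |z| := by
    intro z
    rcases le_total 0 c with hc | hc
    · rw [abs_of_nonneg hc]
      exact smul_le_smul_of_nonneg_left (le_abs_self z) hc
    · rw [abs_of_nonpos hc, ← neg_smul_neg]
      exact smul_le_smul_of_nonneg_left (neg_le_abs z) (neg_nonneg.2 hc)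
  refine abs_le'.2 ⟨key z, ?_⟩
  simpa using key (-z)

theorem smul_inf_eq_zero {a w : L} (ha : 0 ≤ a) (hw : 0 ≤ w) (haw : a ⊓ w = 0)
    {t : ℝ} (ht : 0 ≤ t) : (t • a) ⊓ w = 0 := by
  obtain ⟨n, hn⟩ := exists_nat_ge t
  have key : ∀ n : ℕ, (n • a) ⊓ w = 0 := by
    intro n
    induction n with
    | zero => simpa using hw
    | succ n ih =>
      rw [succ_nsmul]
      exact inf_add_eq_zero (nsmul_nonneg ha n) ha hw ih haw
  refine le_antisymm ?_ (le_inf (smul_nonneg ht ha) hw)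
  rw [← key n, ← Nat.cast_smul_eq_nsmul ℝ]
  exact inf_le_inf_right _ (smul_le_smul_of_nonneg_right hn ha)

/-- The disjoint complement of an element. -/
def disjointCompl (w : L) : Submodule ℝ L where
  carrier := {z | |z| ⊓ |w| = 0}
  zero_mem' := by simp
  add_mem' {a b} ha hb := le_antisymm
    ((inf_le_inf_right _ (abs_add_le a b)).trans
      (inf_add_eq_zero (abs_nonneg a) (abs_nonneg b) (abs_nonneg w) ha hb).le)
    (le_inf (abs_nonneg _) (abs_nonneg _))
  smul_mem' c z hz := le_antisymm
    ((inf_le_inf_right _ (abs_smul_le c z)).trans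
      (smul_inf_eq_zero (abs_nonneg z) (abs_nonneg w) hz (abs_nonneg c)).le)
    (le_inf (abs_nonneg _) (abs_nonneg _))

theorem mem_disjointCompl {z w : L} : z ∈ disjointCompl w ↔ |z| ⊓ |w| = 0 := Iff.rfl

theorem mem_disjointCompl_comm {z w : L} : z ∈ disjointCompl w ↔ w ∈ disjointCompl z := by
  rw [mem_disjointCompl, mem_disjointCompl, inf_comm]

theorem eq_zero_of_mem_disjointCompl_self {z : L} (h : z ∈ disjointCompl z) : z = 0 :=
  eq_zero_of_abs_eq_zero (by simpa [mem_disjointCompl] using h)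

theorem isIdeal_disjointCompl (w : L) : IsIdeal (disjointCompl w) := fun _ _ hxy hy =>
  le_antisymm ((inf_le_inf_right _ hxy).trans (le_of_eq hy))
    (le_inf (abs_nonneg _) (abs_nonneg _))

theorem posPart_mem_disjointCompl_negPart (x : L) : x⁺ ∈ disjointCompl x⁻ := by
  rw [mem_disjointCompl, abs_of_nonneg (posPart_nonneg x), abs_of_nonneg (negPart_nonneg x),
    posPart_inf_negPart_eq_zero]

theorem abs_le_abs_sum {ι : Type*} [DecidableEq ι] (s : Finset ι) (y : ι → L)
    (h : ∀ i ∈ s, ∀ j ∈ s, i ≠ j → y i ∈ disjointCompl (y j)) {j : ι} (hj : j ∈ s) :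
    |y j| ≤ |∑ i ∈ s, y i| := by
  have hrest : ∑ i ∈ s.erase j, y i ∈ disjointCompl (y j) :=
    Submodule.sum_mem _ fun i hi => h i (Finset.mem_of_mem_erase hi) j hj (Finset.ne_of_mem_erase hi)
  rw [← Finset.add_sum_erase s y hj]
  set z := ∑ i ∈ s.erase j, y i
  -- The right-hand side is zero by disjointness, which gives the claim.
  have h1 : |y j| - |y j + z| ≤ |z| ⊓ |y j| := by
    refine le_inf ?_ (sub_le_self _ (abs_nonneg _))
    rw [sub_le_iff_le_add']
    simpa using abs_add_le (y j + z) (-z)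
  rw [mem_disjointCompl.1 hrest] at h1
  exact sub_nonpos.1 h1

theorem sum_le_of_disjoint {ι : Type*} [DecidableEq ι] (s : Finset ι) (x : ι → L) {y : L}
    (h : ∀ i ∈ s, ∀ j ∈ s, i ≠ j → x i ∈ disjointCompl (x j)) (hx : ∀ i ∈ s, 0 ≤ x i)
    (hy : 0 ≤ y) (hxy : ∀ i ∈ s, x i ≤ y) : ∑ i ∈ s, x i ≤ y := by
  induction s using Finset.induction_on with
  | empty => simpa using hy
  | insert a s ha ih =>
    rw [Finset.sum_insert ha]
    have h1 : ∑ i ∈ s, x i ∈ disjointCompl (x a) := Submodule.sum_mem _ fun i hi =>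
      h i (Finset.mem_insert_of_mem hi) a (Finset.mem_insert_self a s)
        (fun e => ha (e ▸ hi))
    have h0 : 0 ≤ ∑ i ∈ s, x i := Finset.sum_nonneg fun i hi => hx i (Finset.mem_insert_of_mem hi)
    have ha0 := hx a (Finset.mem_insert_self a s)
    rw [mem_disjointCompl, abs_of_nonneg h0, abs_of_nonneg ha0] at h1
    -- For disjoint positive elements the sum is the supremum.
    rw [add_comm, ← inf_add_sup, h1, zero_add]
    refine sup_le (ih ?_ ?_ ?_) (hxy a (Finset.mem_insert_self a s))
    · exact fun i hi j hj => h i (Finset.mem_insert_of_mem hi) j (Finset.mem_insert_of_mem hj)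
    · exact fun i hi => hx i (Finset.mem_insert_of_mem hi)
    · exact fun i hi => hxy i (Finset.mem_insert_of_mem hi)

end Ideal

end BanachLattice

namespace BanachLattice

/-! ### Finite-dimensional vector sublattices. -/

section FiniteDimensional

variable {L : Type u} [NormedAddCommGroup L] [NormedSpace ℝ L] [Lattice L]
  [IsOrderedAddMonoid L] [IsOrderedModule ℝ L]

omit [IsOrderedModule ℝ L] in
theorem posPart_mem_of_abs_mem {R : Submodule ℝ L} (hR : ∀ x ∈ R, |x| ∈ R) {x : L}
    (hx : x ∈ R) : x⁺ ∈ R := by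
  have h : x⁺ = (1 / 2 : ℝ) • (x + |x|) := by
    have : x + |x| = (2 : ℝ) • x⁺ := by
      rw [← posPart_add_negPart x, two_smul]
      nth_rw 1 [← posPart_sub_negPart x]
      abel
    rw [this, smul_smul]
    norm_num
  rw [h]
  exact R.smul_mem _ (R.add_mem hx (hR x hx))

omit [IsOrderedModule ℝ L] in
theorem negPart_mem_of_abs_mem {R : Submodule ℝ L} (hR : ∀ x ∈ R, |x| ∈ R) {x : L}
    (hx : x ∈ R) : x⁻ ∈ R := by
  rw [← posPart_neg]
  exact posPart_mem_of_abs_mem hR (R.neg_mem hx)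

omit [IsOrderedModule ℝ L] in
theorem inf_mem_of_abs_mem {R : Submodule ℝ L} (hR : ∀ x ∈ R, |x| ∈ R) {x y : L}
    (hx : x ∈ R) (hy : y ∈ R) : x ⊓ y ∈ R := by
  rw [inf_eq_sub_posPart_sub]
  exact R.sub_mem hx (posPart_mem_of_abs_mem hR (R.sub_mem hx hy))

variable [HasSolidNorm L]

/-- In a totally ordered subspace every element is a multiple of a given nonzero positive one. -/
theorem exists_eq_smul_of_total {R : Submodule ℝ L} (hR : ∀ y ∈ R, 0 ≤ y ∨ y ≤ 0) {x y : L}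
    (hx : x ∈ R) (hx0 : 0 ≤ x) (hx1 : x ≠ 0) (hy : y ∈ R) : ∃ c : ℝ, y = c • x := by
  have harch : ∀ y : L, ∃ c : ℝ, ¬ c • x ≤ y := by
    intro y
    have hxn : 0 < ‖x‖ := norm_pos_iff.2 hx1
    -- This multiple of `x` has norm `‖y‖ + 1`, so solidity of the norm forbids it to lie below `y`.
    refine ⟨(‖y‖ + 1) / ‖x‖, fun h => ?_⟩
    have hc : 0 ≤ (‖y‖ + 1) / ‖x‖ := by positivity
    have h1 : ‖((‖y‖ + 1) / ‖x‖) • x‖ ≤ ‖y‖ :=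
      norm_le_norm_of_abs_le_abs (by
        have h0 : 0 ≤ ((‖y‖ + 1) / ‖x‖) • x := smul_nonneg hc hx0
        rwa [abs_of_nonneg h0, abs_of_nonneg (h0.trans h)])
    rw [norm_smul, Real.norm_of_nonneg hc, div_mul_cancel₀ _ hxn.ne'] at h1
    linarith
  have htot : ∀ c : ℝ, c • x ≤ y ∨ y ≤ c • x := by
    intro c
    rcases hR _ (R.sub_mem hy (R.smul_mem c hx)) with h | h
    · exact Or.inl (sub_nonneg.1 h)
    · exact Or.inr (sub_nonpos.1 h)
  have hcont : Continuous fun c : ℝ => c • x := by fun_prop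
  obtain ⟨c₁, h₁⟩ := harch y
  obtain ⟨c₂, h₂⟩ := harch (-y)
  -- The two closed sets of scalars cover the connected real line and are nonempty, so they share a
  -- point `c`, where `y = c • x`.
  have hne := isPreconnected_closed_iff.1 isPreconnected_univ {c : ℝ | c • x ≤ y} {c : ℝ | y ≤ c • x}
    (isClosed_le hcont continuous_const) (isClosed_le continuous_const hcont)
    (fun c _ => htot c)
    ⟨-c₂, trivial, (htot _).resolve_right fun h => h₂ (by
      rw [neg_smul] at h
      exact le_neg.1 h)⟩
    ⟨c₁, trivial, (htot _).resolve_left h₁⟩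
  obtain ⟨c, -, hc1, hc2⟩ := hne
  exact ⟨c, le_antisymm hc2 hc1⟩

/-- Solidity of the norm bounds the admissible `c` by `‖y‖ / ‖x‖`, so they form a compact set. -/
theorem exists_isGreatest_smul_le {x y : L} (hx0 : 0 ≤ x) (hx1 : x ≠ 0) (hy : 0 ≤ y) :
    ∃ c : ℝ, IsGreatest {c : ℝ | 0 ≤ c ∧ c • x ≤ y} c := by
  have hcont : Continuous fun c : ℝ => c • x := by fun_prop
  refine IsCompact.exists_isGreatest ?_ ⟨0, le_rfl, by simpa using hy⟩
  refine Metric.isCompact_of_isClosed_isBounded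
    (isClosed_Ici.inter (isClosed_le hcont continuous_const)) ?_
  refine (Metric.isBounded_Icc 0 (‖y‖ / ‖x‖)).subset fun c hc => ⟨hc.1, ?_⟩
  have h1 : ‖c • x‖ ≤ ‖y‖ := norm_le_norm_of_abs_le_abs (by
    rw [abs_of_nonneg hy, abs_of_nonneg (smul_nonneg hc.1 hx0)]
    exact hc.2)
  rw [norm_smul, Real.norm_of_nonneg hc.1] at h1
  rwa [le_div_iff₀ (norm_pos_iff.2 hx1)]

/-- A finite set of pairwise disjoint nonzero positive elements of `R`. -/
structure IsDisjointSystem (R : Submodule ℝ L) (s : Finset L) : Prop where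
  mem : ∀ x ∈ s, x ∈ R
  nonneg : ∀ x ∈ s, 0 ≤ x
  ne_zero : ∀ x ∈ s, x ≠ 0
  disjoint : ∀ x ∈ s, ∀ y ∈ s, x ≠ y → x ∈ disjointCompl y

omit [HasSolidNorm L] in
-- In a vanishing combination, a term with nonzero coefficient would be disjoint from its own
-- vector.
theorem IsDisjointSystem.linearIndependent {R : Submodule ℝ L} {s : Finset L}
    (hs : IsDisjointSystem R s) : LinearIndependent ℝ ((↑) : s → L) := by
  classical
  rw [linearIndependent_iff']
  intro t g hg i hi
  by_contra hgi
  have h1 : ∑ j ∈ t.erase i, g j • (j : L) ∈ disjointCompl (i : L) :=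
    Submodule.sum_mem _ fun j hj => Submodule.smul_mem _ _ <|
      hs.disjoint j j.2 i i.2 fun e => Finset.ne_of_mem_erase hj (Subtype.ext e)
  rw [← Finset.add_sum_erase t _ hi, add_eq_zero_iff_eq_neg] at hg
  have h2 : g i • (i : L) ∈ disjointCompl (i : L) := hg ▸ Submodule.neg_mem _ h1
  exact hs.ne_zero i i.2 (eq_zero_of_mem_disjointCompl_self
    ((Submodule.smul_mem_iff _ hgi).1 h2))

omit [HasSolidNorm L] in
theorem IsDisjointSystem.card_le {R : Submodule ℝ L} [FiniteDimensional ℝ R] {s : Finset L}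
    (hs : IsDisjointSystem R s) : s.card ≤ Module.finrank ℝ R := by
  have h := finrank_span_finset_eq_card hs.linearIndependent
  rw [← h]
  exact Submodule.finrank_mono (Submodule.span_le.2 hs.mem)

omit [HasSolidNorm L] in
theorem IsDisjointSystem.insert [DecidableEq L] {R : Submodule ℝ L} {s : Finset L}
    (hs : IsDisjointSystem R s) {y : L} (hy : y ∈ R) (hy0 : 0 ≤ y) (hy1 : y ≠ 0)
    (h : ∀ x ∈ s, y ∈ disjointCompl x) :
    y ∉ s ∧ IsDisjointSystem R (insert y s) := by
  refine ⟨fun hys => hy1 (eq_zero_of_mem_disjointCompl_self (h y hys)), ?_, ?_, ?_, ?_⟩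
  · simpa using ⟨hy, hs.mem⟩
  · simpa using ⟨hy0, hs.nonneg⟩
  · exact fun x hx => (Finset.mem_insert.1 hx).elim (fun e => e ▸ hy1) (hs.ne_zero x)
  · intro a ha b hb hab
    rcases Finset.mem_insert.1 ha with rfl | ha' <;> rcases Finset.mem_insert.1 hb with rfl | hb'
    · exact absurd rfl hab
    · exact h b hb'
    · exact mem_disjointCompl_comm.1 (h a ha')
    · exact hs.disjoint a ha' b hb' hab

omit [HasSolidNorm L] in
theorem IsDisjointSystem.mono {R : Submodule ℝ L} {s t : Finset L}
    (hs : IsDisjointSystem R s) (h : t ⊆ s) : IsDisjointSystem R t :=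
  ⟨fun x hx => hs.mem x (h hx), fun x hx => hs.nonneg x (h hx), fun x hx => hs.ne_zero x (h hx),
    fun x hx y hy => hs.disjoint x (h hx) y (h hy)⟩

omit [HasSolidNorm L] in
theorem exists_maximal_isDisjointSystem (R : Submodule ℝ L) [FiniteDimensional ℝ R] :
    ∃ s : Finset L, IsDisjointSystem R s ∧ ∀ t, IsDisjointSystem R t → t.card ≤ s.card := by
  have h := Nat.sSup_mem (s := {n | ∃ s : Finset L, IsDisjointSystem R s ∧ s.card = n})
    ⟨0, ∅, ⟨by simp, by simp, by simp, by simp⟩, rfl⟩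
    ⟨Module.finrank ℝ R, fun n ⟨s, hs, hn⟩ => hn ▸ hs.card_le⟩
  obtain ⟨s, hs, hn⟩ := h
  refine ⟨s, hs, fun t ht => hn ▸ le_csSup ?_ ⟨t, ht, rfl⟩⟩
  exact ⟨Module.finrank ℝ R, fun n ⟨s, hs, hn⟩ => hn ▸ hs.card_le⟩

/-- A finite-dimensional vector sublattice is spanned by a disjoint system, each member of which
spans the elements disjoint from all the other members. -/
theorem exists_disjointSystem_span (R : Submodule ℝ L) [FiniteDimensional ℝ R]
    (hR : ∀ x ∈ R, |x| ∈ R) :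
    ∃ s : Finset L, IsDisjointSystem R s ∧ R ≤ Submodule.span ℝ (s : Set L) ∧
      ∀ y ∈ R, ∀ x ∈ s, (∀ z ∈ s, z ≠ x → y ∈ disjointCompl z) → ∃ c : ℝ, y = c • x := by
  classical
  obtain ⟨s, hs, hmax⟩ := exists_maximal_isDisjointSystem R
  have hmul : ∀ y ∈ R, ∀ x ∈ s, (∀ z ∈ s, z ≠ x → y ∈ disjointCompl z) → ∃ c : ℝ, y = c • x := by
    intro y hy x hx hyx
    let D : Submodule ℝ L := R ⊓ ⨅ z ∈ s.erase x, disjointCompl z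
    have hD : ∀ y, y ∈ D ↔ y ∈ R ∧ ∀ z ∈ s, z ≠ x → y ∈ disjointCompl z := by
      intro y
      simp only [D, Submodule.mem_inf, Submodule.mem_iInf, Finset.mem_erase]
      exact and_congr_right fun _ => ⟨fun h z hz hzx => h z ⟨hzx, hz⟩, fun h z hz => h z hz.2 hz.1⟩
    refine exists_eq_smul_of_total (R := D) ?_ ((hD x).2 ⟨hs.mem x hx, fun z hz hzx =>
      hs.disjoint x hx z hz hzx.symm⟩) (hs.nonneg x hx) (hs.ne_zero x hx) ((hD y).2 ⟨hy, hyx⟩)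
    intro w hw
    obtain ⟨hwR, hwd⟩ := (hD w).1 hw
    by_contra hcon
    rw [not_or] at hcon
    -- If both parts of `w` are nonzero, replacing `x` by `w⁺` and `w⁻` gives a larger disjoint
    -- system.
    have h1 := (hs.mono (s.erase_subset x)).insert (posPart_mem_of_abs_mem hR hwR)
      (posPart_nonneg w) (fun h => hcon.2 (posPart_eq_zero.1 h)) fun z hz =>
        isIdeal_disjointCompl z (abs_posPart_le w)
          (hwd z (Finset.mem_of_mem_erase hz) (Finset.ne_of_mem_erase hz))
    have h2 := h1.2.insert (negPart_mem_of_abs_mem hR hwR)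
      (negPart_nonneg w) (fun h => hcon.1 (negPart_eq_zero.1 h)) fun z hz => by
        rcases Finset.mem_insert.1 hz with rfl | hz
        · exact mem_disjointCompl_comm.1 (posPart_mem_disjointCompl_negPart w)
        · exact isIdeal_disjointCompl z (abs_negPart_le w)
            (hwd z (Finset.mem_of_mem_erase hz) (Finset.ne_of_mem_erase hz))
    have h3 := hmax _ h2.2
    rw [Finset.card_insert_of_notMem h2.1, Finset.card_insert_of_notMem h1.1,
      Finset.card_erase_add_one hx] at h3
    omega
  refine ⟨s, hs, ?_, hmul⟩
  have hpos : ∀ y ∈ R, 0 ≤ y → y ∈ Submodule.span ℝ (s : Set L) := by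
    intro y hy hy0
    -- Subtracting the largest multiple of each `x` that lies below `y` should leave nothing. A
    -- nonzero remainder disjoint from all of `s` would enlarge the system; one that meets some `x`
    -- would allow a larger coefficient there.
    choose! c hc using fun x (hx : x ∈ s) =>
      exists_isGreatest_smul_le (hs.nonneg x hx) (hs.ne_zero x hx) hy0
    have hle : ∑ x ∈ s, c x • x ≤ y := by
      refine sum_le_of_disjoint s _ (fun i hi j hj hij => ?_)
        (fun x hx => smul_nonneg (hc x hx).1.1 (hs.nonneg x hx)) hy0 (fun x hx => (hc x hx).1.2)
      exact Submodule.smul_mem _ _ (mem_disjointCompl_comm.1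
        (Submodule.smul_mem _ _ (hs.disjoint j hj i hi hij.symm)))
    have hsum : ∑ x ∈ s, c x • x ∈ Submodule.span ℝ (s : Set L) :=
      Submodule.sum_mem _ fun x hx => Submodule.smul_mem _ _ (Submodule.subset_span hx)
    suffices hz : y - ∑ x ∈ s, c x • x = 0 by
      rw [sub_eq_zero.1 hz]; exact hsum
    have hzR : y - ∑ x ∈ s, c x • x ∈ R := R.sub_mem hy
      (Submodule.sum_mem _ fun x hx => R.smul_mem _ (hs.mem x hx))
    have hz0 := sub_nonneg.2 hle
    by_contra hz1
    have hnot : ¬ ∀ x ∈ s, y - ∑ x ∈ s, c x • x ∈ disjointCompl x := by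
      intro h
      have h1 := hs.insert hzR hz0 hz1 h
      have h2 := hmax _ h1.2
      rw [Finset.card_insert_of_notMem h1.1] at h2
      omega
    push Not at hnot
    obtain ⟨x, hx, hzx⟩ := hnot
    have hx0 := hs.nonneg x hx
    rw [mem_disjointCompl, abs_of_nonneg hz0, abs_of_nonneg hx0] at hzx
    have hw0 : 0 ≤ (y - ∑ x ∈ s, c x • x) ⊓ x := le_inf hz0 hx0
    -- The part of the remainder below `x` is disjoint from the other members of `s`, hence a
    -- multiple of `x`.
    obtain ⟨t, ht⟩ := hmul _ (inf_mem_of_abs_mem hR hzR (hs.mem x hx)) x hx fun z hz hzx =>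
      isIdeal_disjointCompl z (by
        rw [abs_of_nonneg hw0, abs_of_nonneg hx0]; exact inf_le_right)
        (hs.disjoint x hx z hz hzx.symm)
    have htpos : 0 < t := by
      by_contra htn
      have h1 : t • x ≤ 0 := by
        have := smul_nonneg (neg_nonneg.2 (not_lt.1 htn)) hx0
        rwa [neg_smul, neg_nonneg] at this
      exact hzx (le_antisymm (ht ▸ h1) hw0)
    have hmem : c x + t ∈ {c : ℝ | 0 ≤ c ∧ c • x ≤ y} := by
      refine ⟨add_nonneg (hc x hx).1.1 htpos.le, ?_⟩
      rw [add_smul, ← ht]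
      have h1 : c x • x ≤ ∑ x ∈ s, c x • x :=
        Finset.single_le_sum (f := fun x => c x • x)
          (fun x hx => smul_nonneg (hc x hx).1.1 (hs.nonneg x hx)) hx
      calc c x • x + (y - ∑ x ∈ s, c x • x) ⊓ x
          ≤ ∑ x ∈ s, c x • x + (y - ∑ x ∈ s, c x • x) := add_le_add h1 inf_le_left
        _ = y := by abel
    have := (hc x hx).2 hmem
    linarith
  intro y hy
  rw [← posPart_sub_negPart y]
  exact Submodule.sub_mem _ (hpos _ (posPart_mem_of_abs_mem hR hy) (posPart_nonneg y))
    (hpos _ (negPart_mem_of_abs_mem hR hy) (negPart_nonneg y))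

end FiniteDimensional

end BanachLattice

namespace BanachLattice

/-! ### Closed ideals and positive functionals. -/

section ClosedIdeal

variable {L : Type u} [NormedAddCommGroup L] [NormedSpace ℝ L] [Lattice L]
  [IsOrderedAddMonoid L] [HasSolidNorm L]

omit [IsOrderedAddMonoid L] [NormedSpace ℝ L] in
/-- In an order continuous norm, order convergence implies norm convergence, so norm closed sets
are order closed. -/
theorem isOrderClosed_of_isClosed (hL : HasOrderContinuousNorm L) {S : Set L} (hS : IsClosed S) :
    IsOrderClosed S := by
  intro ι _ _ _ x a hx ⟨y, hy, hy0, hxy⟩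
  have h := (hL ι y hy hy0).norm
  rw [norm_zero] at h
  have hxa : Tendsto (fun i => x i - a) atTop (𝓝 0) :=
    squeeze_zero_norm (fun i => norm_le_norm_of_abs_le_abs ((hxy i).trans (le_abs_self _))) h
  exact hS.mem_of_tendsto (tendsto_sub_nhds_zero_iff.1 hxa) (Eventually.of_forall hx)

omit [NormedSpace ℝ L] in
theorem continuous_abs : Continuous fun x : L => |x| :=
  continuous_id.sup continuous_neg

/-- The closed ideal generated by an element. -/
def closedIdealSpan (x : L) : Submodule ℝ L :=
  sInf {J | IsClosedIdeal J ∧ x ∈ J}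

omit [IsOrderedAddMonoid L] [HasSolidNorm L] in
theorem isClosedIdeal_closedIdealSpan (x : L) : IsClosedIdeal (closedIdealSpan x) := by
  refine ⟨fun a b hab hb => ?_, ?_⟩
  · rw [closedIdealSpan, Submodule.mem_sInf] at hb ⊢
    exact fun J hJ => hJ.1.1 hab (hb J hJ)
  · rw [closedIdealSpan, Submodule.coe_sInf]
    exact isClosed_biInter fun J hJ => hJ.1.2

omit [IsOrderedAddMonoid L] [HasSolidNorm L] in
theorem mem_closedIdealSpan (x : L) : x ∈ closedIdealSpan x :=
  Submodule.mem_sInf.2 fun _ hJ => hJ.2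

omit [IsOrderedAddMonoid L] [HasSolidNorm L] in
theorem closedIdealSpan_le {x : L} {J : Submodule ℝ L} (hJ : IsClosedIdeal J) (hx : x ∈ J) :
    closedIdealSpan x ≤ J :=
  sInf_le ⟨hJ, hx⟩

variable [IsOrderedModule ℝ L]

theorem isClosedIdeal_disjointCompl (w : L) : IsClosedIdeal (disjointCompl w) := by
  refine ⟨isIdeal_disjointCompl w, ?_⟩
  have : Continuous fun z : L => |z| ⊓ |w| := continuous_abs.inf continuous_const
  exact isClosed_singleton.preimage this

theorem closedIdealSpan_disjoint {x y a b : L} (h : x ∈ disjointCompl y)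
    (ha : a ∈ closedIdealSpan x) (hb : b ∈ closedIdealSpan y) : a ∈ disjointCompl b := by
  have h1 := closedIdealSpan_le (isClosedIdeal_disjointCompl y) h ha
  exact mem_disjointCompl_comm.1
    (closedIdealSpan_le (isClosedIdeal_disjointCompl a) (mem_disjointCompl_comm.1 h1) hb)

/-- A finite sum of pairwise disjoint closed ideals is closed. -/
theorem isClosed_iSup_of_disjoint [CompleteSpace L] {ι : Type*} [Fintype ι]
    (J : ι → Submodule ℝ L) (hJ : ∀ i, IsClosed (J i : Set L))
    (hd : ∀ i j, i ≠ j → ∀ x ∈ J i, ∀ y ∈ J j, x ∈ disjointCompl y) :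
    IsClosed ((⨆ i, J i : Submodule ℝ L) : Set L) := by
  classical
  have hc : ∀ i, CompleteSpace (J i) := fun i => (hJ i).completeSpace_coe
  let Φ : (∀ i, J i) →L[ℝ] L := ∑ i, (J i).subtypeL ∘L ContinuousLinearMap.proj i
  have hΦ : ∀ y, Φ y = ∑ i, (y i : L) := fun y => by simp [Φ]
  -- Disjointness gives `|y i| ≤ |∑ y|`, so the summation map is bounded below and has closed range.
  have hanti : AntilipschitzWith 1 Φ := by
    refine AddMonoidHomClass.antilipschitz_of_bound Φ fun y => ?_
    rw [NNReal.coe_one, one_mul, pi_norm_le_iff_of_nonneg (norm_nonneg _)]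
    intro i
    rw [hΦ]
    exact norm_le_norm_of_abs_le_abs (abs_le_abs_sum Finset.univ (fun i => (y i : L))
      (fun i _ j _ hij => hd i j hij _ (y i).2 _ (y j).2) (Finset.mem_univ i))
  have hrange : ((⨆ i, J i : Submodule ℝ L) : Set L) = Set.range Φ := by
    apply subset_antisymm
    · have : ⨆ i, J i ≤ (Φ : (∀ i, J i) →ₗ[ℝ] L).range := by
        refine iSup_le fun i x hx => ⟨Pi.single i ⟨x, hx⟩, ?_⟩
        change Φ _ = x
        rw [hΦ, Finset.sum_eq_single i]
        · simp
        · intro j _ hji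
          simp [hji]
        · simp
      exact this
    · rintro _ ⟨y, rfl⟩
      rw [hΦ]
      exact Submodule.sum_mem _ fun i _ => Submodule.mem_iSup_of_mem i (y i).2
  rw [hrange]
  exact hanti.isClosed_range Φ.uniformContinuous

/-- A proper closed ideal is annihilated by a nonzero positive functional. -/
theorem exists_positive_functional {J : Submodule ℝ L} (hJ : IsClosedIdeal J) (hne : J ≠ ⊤) :
    ∃ f : StrongDual ℝ L, DualLE 0 f ∧ f ≠ 0 ∧ ∀ x ∈ J, f x = 0 := by
  obtain ⟨z, hz⟩ : ∃ z, z ∉ J := by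
    by_contra h
    push Not at h
    exact hne (eq_top_iff.2 fun x _ => h x)
  -- A closed convex cone containing both `J` and the negative cone. A functional that is
  -- nonpositive on it is therefore positive and vanishes on `J`.
  let s : Set L := {x | x⁺ ∈ J}
  have hsmul : ∀ {x : L}, x ∈ s → ∀ {c : ℝ}, 0 ≤ c → c • x ∈ s := by
    intro x hx c hc
    refine hJ.1 (y := c • x⁺) ?_ (J.smul_mem c hx)
    rw [abs_of_nonneg (posPart_nonneg _), abs_of_nonneg (smul_nonneg hc (posPart_nonneg _))]
    exact sup_le (smul_le_smul_of_nonneg_left (le_posPart x) hc)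
      (smul_nonneg hc (posPart_nonneg _))
  have hadd : ∀ {x y : L}, x ∈ s → y ∈ s → x + y ∈ s := by
    intro x y hx hy
    refine hJ.1 (y := x⁺ + y⁺) ?_ (J.add_mem hx hy)
    have h0 := add_nonneg (posPart_nonneg x) (posPart_nonneg y)
    rw [abs_of_nonneg (posPart_nonneg _), abs_of_nonneg h0]
    exact sup_le (add_le_add (le_posPart x) (le_posPart y)) h0
  have hconv : Convex ℝ s := fun x hx y hy a b ha hb _ => hadd (hsmul hx ha) (hsmul hy hb)
  have hclosed : IsClosed s := hJ.2.preimage continuous_posPart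
  have hzs : |z| ∉ s := by
    intro h
    change |z|⁺ ∈ J at h
    rw [posPart_eq_self.2 (abs_nonneg z)] at h
    exact hz (hJ.1.of_abs_mem h)
  obtain ⟨f, u, hfs, hfz⟩ := geometric_hahn_banach_closed_point hconv hclosed hzs
  have hu : 0 < u := by
    have h0 : (0 : L) ∈ s := by simp [s]
    simpa using hfs 0 h0
  have hf : ∀ x ∈ s, f x ≤ 0 := by
    intro x hx
    by_contra h
    push Not at h
    -- Scaling by `u / f x` would make `f` attain the strict bound `u` on the cone.
    have := hfs _ (hsmul hx (div_nonneg hu.le h.le))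
    rw [map_smul, smul_eq_mul, div_mul_cancel₀ _ h.ne'] at this
    exact lt_irrefl _ this
  refine ⟨f, fun x hx => ?_, fun h => ?_, fun x hx => le_antisymm (hf x ?_) ?_⟩
  · have : -x ∈ s := by
      change (-x)⁺ ∈ J
      rw [posPart_eq_zero.2 (neg_nonpos.2 hx)]
      exact J.zero_mem
    simpa using hf _ this
  · rw [h] at hfz
    exact (hu.trans hfz).ne rfl
  · exact hJ.1 (abs_posPart_le x) hx
  · have : -x ∈ s := hJ.1 (abs_posPart_le (-x)) (J.neg_mem hx)
    simpa using hf _ this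

/-- If `P*` is strictly positive, a closed ideal containing the range of `P` is everything. -/
theorem eq_top_of_range_le {P : L →L[ℝ] L} (hP' : IsDualStrictlyPositive (adjoint P))
    {J : Submodule ℝ L} (hJ : IsClosedIdeal J) (h : ∀ x, P x ∈ J) : J = ⊤ := by
  by_contra hne
  obtain ⟨f, hf0, hf1, hfJ⟩ := exists_positive_functional hJ hne
  apply hf1
  have : f ∈ dualAbsKernel (adjoint P) := by
    -- A positive functional is its own modulus.
    refine ⟨f, ⟨fun x _ => le_rfl, fun x hx => ?_, fun θ hθ _ => hθ⟩, ?_⟩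
    · have := hf0 x hx
      simp only [zero_apply, neg_apply] at this ⊢
      linarith
    · ext x
      exact hfJ _ (h x)
  rw [hP'.2] at this
  exact this

end ClosedIdeal

/-! ### Ranges of strictly positive idempotents. -/

section Idempotent

variable {L : Type u} [NormedAddCommGroup L] [NormedSpace ℝ L] [Lattice L]
  [IsOrderedAddMonoid L] {P : L →L[ℝ] L}

theorem abs_map_le (hpos : IsPositive P) (x : L) :
    |P x| ≤ P |x| := by
  refine abs_le'.2 ⟨?_, ?_⟩
  · have := hpos _ (sub_nonneg.2 (le_abs_self x))
    rwa [map_sub, sub_nonneg] at this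
  · have := hpos _ (neg_le_iff_add_nonneg.1 (neg_le_abs x))
    rwa [map_add, ← neg_le_iff_add_nonneg] at this

theorem IsStrictlyPositive.eq_zero (hP : IsStrictlyPositive P) {x : L} (hx : 0 ≤ x)
    (h : P x = 0) : x = 0 := by
  have : x ∈ absKernel P := by
    change P |x| = 0
    rwa [abs_of_nonneg hx]
  rw [hP.2] at this
  exact this

omit [IsOrderedAddMonoid L] [Lattice L] in
theorem map_map_of_isIdempotentElem (hidem : IsIdempotentElem P) (x : L) : P (P x) = P x :=
  congrArg (fun T : L →L[ℝ] L => T x) hidem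

/-- The range of a strictly positive idempotent is a vector sublattice. -/
theorem map_abs_of_map_eq (hP : IsStrictlyPositive P) (hidem : IsIdempotentElem P) {x : L}
    (hx : P x = x) : P |x| = |x| := by
  have h1 := abs_map_le hP.1 x
  rw [hx] at h1
  refine sub_eq_zero.1 (hP.eq_zero (sub_nonneg.2 h1) ?_)
  rw [map_sub, map_map_of_isIdempotentElem hidem, sub_self]

variable [IsOrderedModule ℝ L] [HasSolidNorm L]

/-- The `z` for which `P |z|` lies in the closed ideal generated by `x` themselves form a closed
ideal, and it contains `x`. -/
theorem map_mem_closedIdealSpan (hpos : IsPositive P) {x y : L} (hx : P x = x) (hx0 : 0 ≤ x)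
    (hy : y ∈ closedIdealSpan x) : P y ∈ closedIdealSpan x := by
  have hI := isClosedIdeal_closedIdealSpan x
  have hmono : ∀ {a b : L}, a ≤ b → P a ≤ P b := fun {a b} hab => by
    have := hpos _ (sub_nonneg.2 hab)
    rwa [map_sub, sub_nonneg] at this
  have hP0 : ∀ a : L, abs (P |a|) = P |a| := fun a => abs_of_nonneg (hpos _ (abs_nonneg a))
  let K : Submodule ℝ L :=
    { carrier := {z | P |z| ∈ closedIdealSpan x}
      zero_mem' := by simp
      add_mem' := fun {a b} ha hb => by
        refine hI.1 ?_ (Submodule.add_mem _ ha hb)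
        have h1 := hmono (abs_add_le a b)
        rw [map_add] at h1
        rw [hP0]
        exact h1.trans (le_abs_self _)
      smul_mem' := fun c a ha => by
        refine hI.1 ?_ (Submodule.smul_mem _ |c| ha)
        have h1 := hmono (abs_smul_le c a)
        rw [map_smul] at h1
        rw [hP0]
        exact h1.trans (le_abs_self _) }
  have hK : IsClosedIdeal K := by
    refine ⟨fun a b hab hb => hI.1 ?_ hb, hI.2.preimage (P.continuous.comp continuous_abs)⟩
    rw [hP0, hP0]
    exact hmono hab
  have hxK : x ∈ K := by
    change P |x| ∈ closedIdealSpan x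
    rw [abs_of_nonneg hx0, hx]
    exact mem_closedIdealSpan x
  have h1 : P |y| ∈ closedIdealSpan x := closedIdealSpan_le hK hxK hy
  exact hI.1 ((abs_map_le hpos y).trans (le_abs_self _)) h1

/-- The range of a strictly positive idempotent of rank `r` has a basis of `r` pairwise disjoint
positive elements. -/
theorem exists_disjoint_basis_range {r : ℕ} (hP : IsStrictlyPositive P)
    (hidem : IsIdempotentElem P)
    (hrank : LinearMap.rank (P : L →ₗ[ℝ] L) = (r : Cardinal)) :
    ∃ x : Fin r → L, (∀ i, P (x i) = x i) ∧ (∀ i, 0 ≤ x i) ∧ (∀ i, x i ≠ 0) ∧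
      (∀ i j, i ≠ j → x i ∈ disjointCompl (x j)) ∧
      (∀ y, P y ∈ Submodule.span ℝ (Set.range x)) ∧
      ∀ y i, P y = y → (∀ j, j ≠ i → y ∈ disjointCompl (x j)) → ∃ c : ℝ, y = c • x i := by
  set R : Submodule ℝ L := (P : L →ₗ[ℝ] L).range with hRdef
  have hmem : ∀ y, y ∈ R ↔ P y = y := fun y =>
    ⟨fun ⟨z, hz⟩ => by rw [← hz]; exact map_map_of_isIdempotentElem hidem z, fun h => ⟨y, h⟩⟩
  have hfr : Module.finrank ℝ R = r := Module.finrank_eq_of_rank_eq hrank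
  have hfin : FiniteDimensional ℝ R := by
    rw [FiniteDimensional, ← Module.rank_lt_aleph0_iff]
    exact (show Module.rank ℝ R = r from hrank) ▸ Cardinal.natCast_lt_aleph0
  obtain ⟨s, hs, hspan, hmul⟩ := exists_disjointSystem_span R fun x hx =>
    (hmem _).2 (map_abs_of_map_eq hP hidem ((hmem x).1 hx))
  have hcard : s.card = r := by
    rw [← hfr, ← finrank_span_finset_eq_card hs.linearIndependent,
      le_antisymm hspan (Submodule.span_le.2 hs.mem)]
  let e := s.equivFinOfCardEq hcard
  refine ⟨fun i => (e.symm i : L), fun i => (hmem _).1 (hs.mem _ (e.symm i).2),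
    fun i => hs.nonneg _ (e.symm i).2, fun i => hs.ne_zero _ (e.symm i).2,
    fun i j hij => hs.disjoint _ (e.symm i).2 _ (e.symm j).2 fun h =>
      hij (e.symm.injective (Subtype.ext h)), fun y => ?_, fun y i hy hyj => ?_⟩
  · have h1 : Set.range (fun i => (e.symm i : L)) = (s : Set L) := by
      ext z
      exact ⟨fun ⟨i, hi⟩ => hi ▸ (e.symm i).2, fun hz => ⟨e ⟨z, hz⟩, by simp⟩⟩
    rw [h1]
    exact hspan ⟨y, rfl⟩
  · refine hmul y ((hmem y).2 hy) _ (e.symm i).2 fun z hz hzi => ?_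
    have := hyj (e ⟨z, hz⟩) fun h => hzi (by rw [← h]; simp)
    simpa using this

end Idempotent

end BanachLattice

namespace BanachLattice

/-! ### The component generated by one basis vector. -/

section Component

variable {L : Type u} [NormedAddCommGroup L] [NormedSpace ℝ L] [Lattice L]
  [IsOrderedAddMonoid L] {P : L →L[ℝ] L}

/-- An invariant closed ideal meeting the component generated by `x` contains it. -/
theorem closedIdealSpan_le_of_isInvariant (hP : IsStrictlyPositive P)
    (hidem : IsIdempotentElem P) {x : L}
    (hinv : ∀ y ∈ closedIdealSpan x, P y ∈ closedIdealSpan x)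
    (hmul : ∀ y ∈ closedIdealSpan x, P y = y → ∃ c : ℝ, y = c • x)
    {J : Submodule ℝ L} (hJ : IsClosedIdeal J) (hPJ : IsInvariant P J) {y : L}
    (hyJ : y ∈ J) (hy : y ∈ closedIdealSpan x) (hy0 : y ≠ 0) : closedIdealSpan x ≤ J := by
  have hI := isClosedIdeal_closedIdealSpan x
  obtain ⟨c, hc⟩ := hmul (P |y|) (hinv _ (hI.1.abs_mem hy))
    (map_map_of_isIdempotentElem hidem _)
  have hc0 : c ≠ 0 := by
    rintro rfl
    rw [zero_smul] at hc
    exact hy0 (eq_zero_of_abs_eq_zero (hP.eq_zero (abs_nonneg y) hc))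
  refine closedIdealSpan_le hJ ((Submodule.smul_mem_iff J hc0).1 ?_)
  rw [← hc]
  exact hPJ _ (hJ.1.abs_mem hyJ)

variable [IsOrderedModule ℝ L] [HasSolidNorm L]

/-- If `P` is ideal-triangularizable, the component generated by `x` is totally ordered. -/
theorem nonneg_or_nonpos_of_isIdealTriangularizable (hP : IsStrictlyPositive P)
    (hidem : IsIdempotentElem P) {x : L}
    (hinv : ∀ y ∈ closedIdealSpan x, P y ∈ closedIdealSpan x)
    (hmul : ∀ y ∈ closedIdealSpan x, P y = y → ∃ c : ℝ, y = c • x)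
    (htri : IsIdealTriangularizable P) {y : L} (hy : y ∈ closedIdealSpan x) :
    0 ≤ y ∨ y ≤ 0 := by
  by_contra hcon
  rw [not_or] at hcon
  have hpos : y⁺ ≠ 0 := fun h => hcon.2 (posPart_eq_zero.1 h)
  have hneg : y⁻ ≠ 0 := fun h => hcon.1 (negPart_eq_zero.1 h)
  have hI := isClosedIdeal_closedIdealSpan x
  have hpI : y⁺ ∈ closedIdealSpan x := hI.1 (abs_posPart_le y) hy
  have hnI : y⁻ ∈ closedIdealSpan x := hI.1 (abs_negPart_le y) hy
  obtain ⟨C, hC, hCinv⟩ := htri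
  -- `N` is the intersection of the chain members containing the component. Cutting it by the
  -- complement of `y⁺` gives a closed ideal comparable with the whole chain, hence in it by
  -- maximality.
  let N : Submodule ℝ L := sInf {J | J ∈ C ∧ closedIdealSpan x ≤ J}
  let M : Submodule ℝ L := N ⊓ disjointCompl y⁺
  have hN : ∀ {z}, z ∈ N ↔ ∀ J ∈ C, closedIdealSpan x ≤ J → z ∈ J := fun {z} => by
    simp only [N, Submodule.mem_sInf, Set.mem_ofPred_eq, and_imp]
  have hM : IsClosedIdeal M := by
    refine ⟨fun a b hab hb => ⟨hN.2 fun J hJ hxJ => ?_, isIdeal_disjointCompl _ hab hb.2⟩, ?_⟩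
    · exact (hC.prop.1 J hJ).1 hab (hN.1 hb.1 J hJ hxJ)
    · rw [Submodule.coe_inf, Submodule.coe_sInf]
      exact (isClosed_biInter fun J hJ => (hC.prop.1 J hJ.1).2).inter
        (isClosedIdeal_disjointCompl _).2
  have hdich : ∀ J ∈ C, closedIdealSpan x ≤ J ∨ J ≤ M := by
    intro J hJ
    by_cases hxJ : closedIdealSpan x ≤ J
    · exact Or.inl hxJ
    have hJI := hC.prop.1 J hJ
    refine Or.inr fun z hz => ⟨hN.2 fun J' hJ' hxJ' => ?_, ?_⟩
    · rcases hC.prop.2.total hJ hJ' with h | h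
      · exact h hz
      · exact absurd (hxJ'.trans h) hxJ
    · by_contra hzy
      rw [SetLike.mem_coe, mem_disjointCompl, abs_of_nonneg (posPart_nonneg y)] at hzy
      have h0 : 0 ≤ |z| ⊓ y⁺ := le_inf (abs_nonneg z) (posPart_nonneg y)
      -- If `z` in `J` is not disjoint from `y⁺`, then `|z| ⊓ y⁺` is a nonzero element of both `J`
      -- and the component.
      refine hxJ (closedIdealSpan_le_of_isInvariant hP hidem hinv hmul hJI (hCinv J hJ)
        (y := |z| ⊓ y⁺) (hJI.1 ?_ hz) (hI.1 ?_ hpI) hzy)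
      · rw [abs_of_nonneg h0]
        exact inf_le_left
      · rw [abs_of_nonneg h0, abs_of_nonneg (posPart_nonneg y)]
        exact inf_le_right
  have hMC : M ∈ C := by
    refine hC.mem_of_prop_insert ⟨?_, hC.prop.2.insert fun J hJ _ => ?_⟩
    · rintro J (rfl | hJ)
      · exact hM
      · exact hC.prop.1 J hJ
    · rcases hdich J hJ with h | h
      · exact Or.inl fun z hz => hN.1 hz.1 J hJ h
      · exact Or.inr h
  have hnM : y⁻ ∈ M := ⟨hN.2 fun J _ hxJ => hxJ hnI,
    mem_disjointCompl_comm.1 (posPart_mem_disjointCompl_negPart y)⟩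
  -- The invariant ideal `M` contains `y⁻ ≠ 0`, hence the whole component and `y⁺`, which is then
  -- disjoint from itself.
  have hxM := closedIdealSpan_le_of_isInvariant hP hidem hinv hmul hM (hCinv M hMC) hnM hnI hneg
  exact hpos (eq_zero_of_mem_disjointCompl_self (hxM hpI).2)

/-- The difference `y - P y` lies in the kernel of `P` and has a sign, so strict positivity makes it
zero. -/
theorem map_eq_of_isIdealTriangularizable (hP : IsStrictlyPositive P)
    (hidem : IsIdempotentElem P) {x : L}
    (hinv : ∀ y ∈ closedIdealSpan x, P y ∈ closedIdealSpan x)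
    (hmul : ∀ y ∈ closedIdealSpan x, P y = y → ∃ c : ℝ, y = c • x)
    (htri : IsIdealTriangularizable P) {y : L} (hy : y ∈ closedIdealSpan x) : P y = y := by
  have h0 : P (y - P y) = 0 := by
    rw [map_sub, map_map_of_isIdempotentElem hidem, sub_self]
  rcases nonneg_or_nonpos_of_isIdealTriangularizable hP hidem hinv hmul htri
    (Submodule.sub_mem _ hy (hinv y hy)) with h | h
  · exact (sub_eq_zero.1 (hP.eq_zero h h0)).symm
  · have := hP.eq_zero (neg_nonneg.2 h) (by rw [map_neg, h0, neg_zero])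
    exact (sub_eq_zero.1 (neg_eq_zero.1 this)).symm

/-- The band generated by `x`, in an order continuous norm. -/
def closedIdealBand (hL : HasOrderContinuousNorm L) (x : L) : Band L where
  carrier := closedIdealSpan x
  isIdeal := (isClosedIdeal_closedIdealSpan x).1
  isOrderClosed := isOrderClosed_of_isClosed hL (isClosedIdeal_closedIdealSpan x).2

omit [IsOrderedModule ℝ L] in
-- A closed ideal of the component is a closed ideal of `L`, because the component is itself a
-- closed ideal; invariance carries over as well.
theorem isIdealIrreducible_restrict (hL : HasOrderContinuousNorm L) (hP : IsStrictlyPositive P)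
    (hidem : IsIdempotentElem P) {x : L}
    (hinv : ∀ y ∈ closedIdealSpan x, P y ∈ closedIdealSpan x)
    (hmul : ∀ y ∈ closedIdealSpan x, P y = y → ∃ c : ℝ, y = c • x)
    {Q : (closedIdealBand hL x).carrier →L[ℝ] (closedIdealBand hL x).carrier}
    (hQ : ∀ y : (closedIdealBand hL x).carrier, P (y : L) = (Q y : L)) : IsIdealIrreducible Q := by
  rintro ⟨K, hK, hbot, htop, hKinv⟩
  have hI := isClosedIdeal_closedIdealSpan x
  let J : Submodule ℝ L := K.map (closedIdealBand hL x).carrier.subtype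
  have hJ : IsClosedIdeal J := by
    refine ⟨?_, ?_⟩
    · rintro a _ hab ⟨b, hb, rfl⟩
      exact ⟨⟨a, hI.1 hab b.2⟩, hK.1 (show _ ≤ |b| from hab) hb, rfl⟩
    · exact (IsClosed.isClosedEmbedding_subtypeVal hI.2).isClosedMap _ hK.2
  have hJinv : IsInvariant P J := by
    rintro _ ⟨b, hb, rfl⟩
    exact ⟨Q b, hKinv b hb, (hQ b).symm⟩
  obtain ⟨y, hy, hy0⟩ := K.ne_bot_iff.1 hbot
  have hle := closedIdealSpan_le_of_isInvariant hP hidem hinv hmul hJ hJinv ⟨y, hy, rfl⟩ y.2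
    fun h => hy0 (Subtype.ext h)
  refine htop (eq_top_iff.2 fun z _ => ?_)
  obtain ⟨w, hw, hwz⟩ := hle z.2
  rwa [← Subtype.ext hwz]

end Component

end BanachLattice

/-! ### Assembly of the decomposition. -/

theorem proposition2p2 {L : Type u} [NormedAddCommGroup L] [NormedSpace ℝ L] [CompleteSpace L]
    [Lattice L] [IsOrderedAddMonoid L] [IsOrderedModule ℝ L] [HasSolidNorm L]
    (hL : BanachLattice.HasOrderContinuousNorm L)
    (P : L →L[ℝ] L) (r : ℕ)
    (hpos : BanachLattice.IsPositive P) (hidem : IsIdempotentElem P)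
    (hrank : LinearMap.rank (P : L →ₗ[ℝ] L) = (r : Cardinal))
    (hP : BanachLattice.IsStrictlyPositive P)
    (hP' : BanachLattice.IsDualStrictlyPositive (BanachLattice.adjoint P)) :
    (∃ (B : Fin r → BanachLattice.Band L)
        (Q : ∀ j, (B j).carrier →L[ℝ] (B j).carrier),
      (∀ i j, i ≠ j → BanachLattice.LatticeDisjoint (B i).carrier (B j).carrier) ∧
      DirectSum.IsInternal (fun j => (B j).carrier) ∧
      (∀ j (x : (B j).carrier), P (x : L) = (Q j x : L)) ∧
      ∀ j, BanachLattice.IsPositive (Q j) ∧ IsIdempotentElem (Q j) ∧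
        LinearMap.rank (Q j : (B j).carrier →ₗ[ℝ] (B j).carrier) = 1 ∧
        BanachLattice.IsIdealIrreducible (Q j)) ∧
    (BanachLattice.IsIdealTriangularizable P →
      Module.rank ℝ L = (r : Cardinal) ∧ P = ContinuousLinearMap.id ℝ L) := by
  open BanachLattice in
  obtain ⟨x, hx, hx0, hx1, hdisj, hspan, hmul⟩ := exists_disjoint_basis_range hP hidem hrank
  have hd : ∀ i j, i ≠ j → ∀ a ∈ closedIdealSpan (x i), ∀ b ∈ closedIdealSpan (x j),
      a ∈ disjointCompl b := fun i j hij a ha b hb =>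
    closedIdealSpan_disjoint (hdisj i j hij) ha hb
  have hinv : ∀ i, ∀ y ∈ closedIdealSpan (x i), P y ∈ closedIdealSpan (x i) := fun i y hy =>
    map_mem_closedIdealSpan hpos (hx i) (hx0 i) hy
  -- Elements of one component are disjoint from every other basis vector.
  have hmul' : ∀ i, ∀ y ∈ closedIdealSpan (x i), P y = y → ∃ c : ℝ, y = c • x i :=
    fun i y hy hPy => hmul y i hPy fun j hji => hd i j hji.symm y hy _ (mem_closedIdealSpan _)
  have htop : ⨆ i, closedIdealSpan (x i) = ⊤ := by
    refine eq_top_of_range_le hP' ⟨isIdeal_iSup fun i => (isClosedIdeal_closedIdealSpan _).1,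
      isClosed_iSup_of_disjoint _ (fun i => (isClosedIdeal_closedIdealSpan _).2) hd⟩ fun y => ?_
    refine Submodule.span_le.2 ?_ (hspan y)
    rintro _ ⟨i, rfl⟩
    exact Submodule.mem_iSup_of_mem i (mem_closedIdealSpan _)
  have hindep : iSupIndep fun i => closedIdealSpan (x i) := by
    intro i
    -- An element common to one component and the sum of the others is disjoint from itself.
    refine Submodule.disjoint_def.2 fun a ha ha' => eq_zero_of_mem_disjointCompl_self ?_
    exact (iSup₂_le fun j hji b hb => hd j i hji b hb a ha :
      ⨆ j, ⨆ (_ : j ≠ i), closedIdealSpan (x j) ≤ disjointCompl a) ha'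
  refine ⟨⟨fun i => closedIdealBand hL (x i), fun i =>
    (P.comp (closedIdealSpan (x i)).subtypeL).codRestrict (closedIdealSpan (x i))
      fun y => hinv i y y.2, ?_, ?_, fun _ _ => rfl, fun i => ⟨?_, ?_, ?_, ?_⟩⟩, fun htri => ?_⟩
  · exact fun i j hij a ha b hb => hd i j hij a ha b hb
  · exact (DirectSum.isInternal_submodule_iff_iSupIndep_and_iSup_eq_top _).2 ⟨hindep, htop⟩
  · exact fun y hy => hpos (y : L) hy
  · ext y
    exact map_map_of_isIdempotentElem hidem (y : L)
  · refine (rank_submodule_eq_one_iff _).2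
      ⟨⟨x i, mem_closedIdealSpan _⟩, ⟨⟨x i, mem_closedIdealSpan _⟩, Subtype.ext (hx i)⟩,
        fun h => hx1 i (congrArg Subtype.val h), ?_⟩
    rintro _ ⟨y, rfl⟩
    obtain ⟨c, hc⟩ := hmul' i _ (hinv i _ y.2) (map_map_of_isIdempotentElem hidem _)
    exact Submodule.mem_span_singleton.2 ⟨c, Subtype.ext hc.symm⟩
  · exact isIdealIrreducible_restrict hL hP hidem (hinv i) (hmul' i) fun _ => rfl
  · have hid : P = ContinuousLinearMap.id ℝ L := by
      ext y
      have hle : ⨆ i, closedIdealSpan (x i) ≤ LinearMap.eqLocus (P : L →ₗ[ℝ] L) LinearMap.id :=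
        iSup_le fun i y hy =>
          map_eq_of_isIdealTriangularizable hP hidem (hinv i) (hmul' i) htri hy
      exact hle (htop ▸ Submodule.mem_top)
    refine ⟨?_, hid⟩
    -- Once `P` is the identity, its rank `r` is the dimension of `L`.
    rw [← hrank, hid, LinearMap.rank, ContinuousLinearMap.coe_id, LinearMap.range_id,
      rank_top]
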